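/- For integers $n\ge2$, $p,q,k\ge0$ and real $s>-1$, put $$S_{pq}(t)=\frac{{}_2F_1(p,q;p+q+n;t)}{{}_2F_1(p,q;p+q+n;1)},\qquad 0\le t\le1,$$ where ${}_2F_1$ is the Gauss hypergeometric function, and $$c_{pq,k}(s)=\int_0^1 t^{n-1}(1-t)^s\Big[\Big(2t\frac{\partial}{\partial t}\Big)^k\big(t^{\frac{p+q}2}S_{pq}(t)\big)\Big]^2\,dt\in[0,+\infty].$$ Then for each $n\ge2$, each $s>-1$ and each $k=0,1,\dots,n$ there exist constants $0<a\le b<+\infty$, depending only on $n,s,k$, such that $$a\le c_{00,0}(s)\le b\quad\text{if }k=0,\qquad c_{00,k}(s)=0\quad\text{if }k>0,$$ and, for all integers $p,q\ge0$ with $p+q>0$, $$a\,[(p+1)(q+1)]^{2k-s-1}\le c_{pq,k}(s)\le b\,[(p+1)(q+1)]^{2k-s-1}.$$ In particular, $c_{pq,k}(s)$ is finite in all these cases. -/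

import Mathlib

open MeasureTheory Set
open scoped ENNReal

noncomputable section

namespace MHarmonic

/-- `S_{pq}(t) = ₂F₁(p, q; p+q+n; t) / ₂F₁(p, q; p+q+n; 1)`. -/
def S (n p q : ℕ) (t : ℝ) : ℝ :=
  ₂F₁ (p : ℝ) (q : ℝ) ((p : ℝ) + q + n) t / ₂F₁ (p : ℝ) (q : ℝ) ((p : ℝ) + q + n) (1 : ℝ)

/-- The operator `2 t ∂/∂t` on functions of one real variable. -/
def normalOp (f : ℝ → ℝ) : ℝ → ℝ := fun t => 2 * t * deriv f t

/-- The function `t ↦ t^{(p+q)/2} S_{pq}(t)`. -/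
def radialPart (n p q : ℕ) (t : ℝ) : ℝ :=
  t ^ (((p : ℝ) + q) / 2) * S n p q t

/-- `c_{pq,k}(s) = ∫₀¹ t^{n-1} (1-t)^s [(2t∂/∂t)^k (t^{(p+q)/2} S_{pq}(t))]² dt`. The integrand is
nonnegative, so the integral is taken as an element of `[0, ∞]`, where the value `∞` means that
it diverges. -/
def c (n p q k : ℕ) (s : ℝ) : ℝ≥0∞ :=
  ∫⁻ t in Ioo (0 : ℝ) 1,
    ENNReal.ofReal (t ^ ((n : ℝ) - 1) * (1 - t) ^ s * (normalOp^[k] (radialPart n p q) t) ^ 2)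

end MHarmonic

end

/-! Write M = (p+1)(q+1). By Gauss's summation theorem the normalized coefficients w_j of S_{pq} are
a probability distribution on ℕ. On (0,1), (2t∂/∂t)^k(t^{(p+q)/2} S_{pq}) = ∑ w_j m_j^k t^{m_j/2}
with m_j = p+q+2j, so everything reduces to moments of m_j.

The moments satisfy ∑ w_j m_j^r ≤ C M^r for r < n and p+q > 0 (`moment_le`): multiplying by m_j^r
amounts, up to constants, to replacing the parameter n by n-r, and Gauss's theorem sums the new
series.

Upper bound (`c_le`): expand the square, bound each integral of t^x(1-t)^s by Γ(s+1)x^{-(s+1)}, and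
separate the two indices by AM-GM. What remains is the square of the moment of order k-(s+1)/2 < n.

Lower bound (`le_c`): the moments of orders 1 and -1 force a fixed share of the mass onto m_j
comparable with M. For 1-t at most 1/(2M) these terms have t^{m_j/2} bounded below, so the series is
at least a multiple of M^k. Integrating over an interval of length 1/(4M) gives M^{2k-s-1}. -/

/-! ### Gauss's summation theorem -/

open Filter Topology in
/-- If `∑ a j` converges and `(x + j) a j` has a limit, that limit is `0`. -/
theorem tendsto_add_mul_eq_zero_of_summable {a : ℕ → ℝ} {x L : ℝ} (ha : Summable a)
    (h : Tendsto (fun j : ℕ => (x + j) * a j) atTop (𝓝 L)) : L = 0 := by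
  by_contra hL
  have h1 : Tendsto (fun j : ℕ => (x + j) / (j : ℝ)) atTop (𝓝 1) := by
    have : Tendsto (fun j : ℕ => x / (j : ℝ) + 1) atTop (𝓝 (0 + 1)) :=
      (tendsto_const_div_atTop_nhds_zero_nat x).add_const 1
    rw [zero_add] at this
    refine this.congr' ?_
    filter_upwards [eventually_gt_atTop 0] with j hj
    have : (j : ℝ) ≠ 0 := by exact_mod_cast hj.ne'
    field_simp
  have h2 : Tendsto (fun j : ℕ => (j : ℝ) * a j) atTop (𝓝 L) := by
    have := h.div h1 one_ne_zero
    rw [div_one] at this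
    refine this.congr' ?_
    have hx : ∀ᶠ j : ℕ in atTop, 0 < x + j := by
      have := tendsto_atTop_add_const_left atTop x (tendsto_natCast_atTop_atTop (R := ℝ))
      exact this.eventually_gt_atTop 0
    filter_upwards [eventually_gt_atTop 0, hx] with j hj hxj
    have : (j : ℝ) ≠ 0 := by exact_mod_cast hj.ne'
    simp only [Pi.div_apply]
    field_simp
  have h3 : (fun j : ℕ => (1 : ℝ)) =O[atTop] fun j : ℕ => (j : ℝ) * a j :=
    (Asymptotics.isBigO_const_left_iff_pos_le_norm one_ne_zero).2
      ⟨|L| / 2, by positivity, by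
        have := h2.norm.eventually (lt_mem_nhds (show |L| / 2 < ‖L‖ by
          rw [Real.norm_eq_abs]; linarith [abs_pos.2 hL]))
        filter_upwards [this] with j hj using hj.le⟩
  -- A nonzero limit makes the harmonic series dominated by the convergent one.
  have h4 : (fun j : ℕ => 1 / (j : ℝ)) =O[atTop] a := by
    have := (Asymptotics.isBigO_refl (fun j : ℕ => 1 / (j : ℝ)) atTop).mul h3
    refine (this.congr' ?_ ?_)
    · filter_upwards with j; simp
    · filter_upwards [eventually_gt_atTop 0] with j hj
      have : (j : ℝ) ≠ 0 := by exact_mod_cast hj.ne'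
      field_simp
  exact Real.not_summable_one_div_natCast (summable_of_isBigO_nat ha h4)

theorem gamma_add_nat_eq_ascPochhammer {x : ℝ} (hx : 0 < x) (j : ℕ) :
    Real.Gamma (x + j) = (ascPochhammer ℝ j).eval x * Real.Gamma x := by
  induction j with
  | zero => simp
  | succ j ih =>
    rw [Nat.cast_succ, ← add_assoc, Real.Gamma_add_one (by positivity), ih,
      ascPochhammer_succ_eval]
    ring

namespace MHarmonic

/-- The terms `(p)_j (q)_j / (j! Γ(p + q + ν + j))` of the regularized Gauss series at `1`. -/
noncomputable def gaussTerm (p q : ℕ) (ν : ℝ) (j : ℕ) : ℝ :=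
  (j.factorial : ℝ)⁻¹ * (ascPochhammer ℝ j).eval (p : ℝ) * (ascPochhammer ℝ j).eval (q : ℝ) *
    (Real.Gamma (p + q + ν + j))⁻¹

theorem ascPochhammer_eval_natCast_nonneg (p j : ℕ) : 0 ≤ (ascPochhammer ℝ j).eval (p : ℝ) := by
  rw [ascPochhammer_nat_eq_natCast_ascFactorial]; positivity

theorem gaussTerm_nonneg (p q : ℕ) {ν : ℝ} (hν : 0 < ν) (j : ℕ) : 0 ≤ gaussTerm p q ν j := by
  have := ascPochhammer_eval_natCast_nonneg p j
  have := ascPochhammer_eval_natCast_nonneg q j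
  have := Real.Gamma_pos_of_pos (show 0 < (p : ℝ) + q + ν + j by positivity)
  unfold gaussTerm
  positivity

theorem gaussTerm_succ (p q : ℕ) {ν : ℝ} (hν : 0 < ν) (j : ℕ) :
    (j + 1) * (p + q + ν + j) * gaussTerm p q ν (j + 1) =
      (p + j) * (q + j) * gaussTerm p q ν j := by
  have h0 : 0 < (p : ℝ) + q + ν + j := by positivity
  have h1 := Real.Gamma_pos_of_pos h0
  simp only [gaussTerm, ascPochhammer_succ_eval, Nat.factorial_succ]
  push_cast
  rw [← add_assoc, Real.Gamma_add_one h0.ne']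
  have : (j.factorial : ℝ) ≠ 0 := by positivity
  field_simp

/-- Raising q by one and lowering j by one leaves the Gamma argument unchanged, which links the
series for q to the one for q + 1. -/
theorem gaussTerm_succ_left (p q : ℕ) {ν : ℝ} (hν : 0 < ν) (j : ℕ) :
    (j + 1) * gaussTerm p q ν (j + 1) = (p + j) * q * gaussTerm p (q + 1) ν j := by
  have h0 : 0 < (p : ℝ) + q + ν + j := by positivity
  have h2 : (ascPochhammer ℝ (j + 1)).eval (q : ℝ) =
      q * (ascPochhammer ℝ j).eval ((q : ℝ) + 1) := by
    simp [ascPochhammer_succ_left, Polynomial.eval_comp]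
  have h3 : (p : ℝ) + q + ν + (j + 1) = p + (q + 1) + ν + j := by ring
  have h1 := Real.Gamma_pos_of_pos (show 0 < (p : ℝ) + (q + 1) + ν + j by positivity)
  simp only [gaussTerm, h2, ascPochhammer_succ_eval, Nat.factorial_succ]
  push_cast
  rw [h3]
  have : (j.factorial : ℝ) ≠ 0 := by positivity
  field_simp

/-- Telescoping form of the contiguous relation in q. Keeping the boundary term makes it exact for
partial sums, before convergence is known for q + 1. -/
theorem sum_gaussTerm_succ (p q : ℕ) {ν : ℝ} (hν : 0 < ν) (N : ℕ) :
    (q + ν) * ∑ j ∈ Finset.range (N + 1), gaussTerm p (q + 1) ν j +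
      (p + N) * gaussTerm p (q + 1) ν N = ∑ j ∈ Finset.range (N + 1), gaussTerm p q ν j := by
  induction N with
  | zero =>
    have h0 : 0 < (p : ℝ) + q + ν := by positivity
    have h1 := Real.Gamma_pos_of_pos h0
    have h2 : (p : ℝ) + (q + 1) + ν = p + q + ν + 1 := by ring
    simp [gaussTerm, h2, Real.Gamma_add_one h0.ne']
    field_simp
    ring
  | succ N ih =>
    rw [Finset.sum_range_succ, Finset.sum_range_succ _ (N + 1), ← ih]
    have h1 := gaussTerm_succ p (q + 1) hν N
    have h2 := gaussTerm_succ_left p q hν N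
    push_cast at h1 h2 ⊢
    have h3 : (N + 1 : ℝ) ≠ 0 := by positivity
    refine mul_left_cancel₀ h3 ?_
    linear_combination h1 - h2

/-- Gauss's summation theorem for nonnegative integers `p`, `q`. -/
theorem hasSum_gaussTerm (p q : ℕ) {ν : ℝ} (hν : 0 < ν) :
    HasSum (gaussTerm p q ν) (Real.Gamma ν / (Real.Gamma (p + ν) * Real.Gamma (q + ν))) := by
  induction q with
  | zero =>
    have h := Real.Gamma_pos_of_pos hν
    convert hasSum_single (f := gaussTerm p 0 ν) 0 ?_ using 1
    · simp [gaussTerm]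
      field_simp
    · intro j hj
      simp [gaussTerm, hj]
  | succ q ih =>
    have hqν : 0 < (q : ℝ) + ν := by positivity
    have hnn := gaussTerm_nonneg p (q + 1) hν
    -- The boundary term is nonnegative, so the identity bounds the partial sums by the known sum
    -- for q.
    have hsum : Summable (gaussTerm p (q + 1) ν) := by
      refine summable_of_sum_range_le (c := (q + ν)⁻¹ *
        (Real.Gamma ν / (Real.Gamma (p + ν) * Real.Gamma (q + ν)))) hnn fun N => ?_
      have h1 := sum_gaussTerm_succ p q hν N
      have h2 := sum_le_hasSum (Finset.range (N + 1)) (fun j _ => gaussTerm_nonneg p q hν j) ih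
      have h3 : 0 ≤ ((p : ℝ) + N) * gaussTerm p (q + 1) ν N := by
        have := hnn N
        positivity
      rw [Finset.sum_range_succ] at h1
      rw [inv_mul_eq_div, le_div_iff₀ hqν]
      have := hnn N
      nlinarith
    have h1 : Filter.Tendsto (fun N : ℕ => ((p : ℝ) + N) * gaussTerm p (q + 1) ν N) Filter.atTop
        (nhds (Real.Gamma ν / (Real.Gamma (p + ν) * Real.Gamma (q + ν)) -
          (q + ν) * ∑' j, gaussTerm p (q + 1) ν j)) := by
      have h2 := (ih.tendsto_sum_nat.comp (Filter.tendsto_add_atTop_nat 1)).sub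
        ((hsum.hasSum.tendsto_sum_nat.comp (Filter.tendsto_add_atTop_nat 1)).const_mul
          ((q : ℝ) + ν))
      refine h2.congr fun N => ?_
      simp only [Function.comp_apply]
      linarith [sum_gaussTerm_succ p q hν N]
    -- The boundary term converges as a difference of convergent sums; summability forces its limit
    -- to be 0.
    have h2 := tendsto_add_mul_eq_zero_of_summable hsum h1
    convert hsum.hasSum using 1
    push_cast
    have h3 : (q : ℝ) + 1 + ν = q + ν + 1 := by ring
    rw [h3, Real.Gamma_add_one hqν.ne', eq_comm]
    have h4 := Real.Gamma_pos_of_pos hqν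
    have h5 := Real.Gamma_pos_of_pos (show 0 < (p : ℝ) + ν by positivity)
    field_simp
    field_simp at h2
    linarith

end MHarmonic

/-! ### Uniform comparison of Gamma ratios with powers -/

namespace MHarmonic

/-- `Γ(y + u) ≲ (y + 1)^(u - v) Γ(y + v)`, uniformly in `y ≥ 0`. -/
def GammaRatioLE (u v : ℝ) : Prop :=
  ∃ C : ℝ, 0 < C ∧ ∀ y : ℝ, 0 ≤ y →
    Real.Gamma (y + u) ≤ C * (y + 1) ^ (u - v) * Real.Gamma (y + v)

theorem GammaRatioLE.refl (u : ℝ) : GammaRatioLE u u :=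
  ⟨1, one_pos, fun y _ => by simp⟩

theorem GammaRatioLE.trans {u v w : ℝ} (h₁ : GammaRatioLE u v) (h₂ : GammaRatioLE v w) :
    GammaRatioLE u w := by
  obtain ⟨C, hC, h₁⟩ := h₁
  obtain ⟨D, hD, h₂⟩ := h₂
  refine ⟨C * D, by positivity, fun y hy => (h₁ y hy).trans ?_⟩
  have hy1 : 0 < y + 1 := by linarith
  calc C * (y + 1) ^ (u - v) * Real.Gamma (y + v)
      ≤ C * (y + 1) ^ (u - v) * (D * (y + 1) ^ (v - w) * Real.Gamma (y + w)) := by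
        gcongr; exact h₂ y hy
    _ = C * D * (y + 1) ^ (u - w) * Real.Gamma (y + w) := by
        rw [show u - w = (u - v) + (v - w) by ring, Real.rpow_add hy1]; ring

theorem add_le_max_mul {u y : ℝ} (hy : 0 ≤ y) : y + u ≤ max 1 u * (y + 1) := by
  have h1 := le_max_left 1 u
  have h2 := le_max_right 1 u
  nlinarith

theorem min_mul_le_add {u y : ℝ} (hy : 0 ≤ y) : min 1 u * (y + 1) ≤ y + u := by
  have h1 := min_le_left 1 u
  have h2 := min_le_right 1 u
  nlinarith

theorem GammaRatioLE.add_one_left {u : ℝ} (hu : 0 < u) : GammaRatioLE (u + 1) u := by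
  refine ⟨max 1 u, by positivity, fun y hy => ?_⟩
  have h0 : 0 < y + u := by linarith
  have h1 := Real.Gamma_pos_of_pos h0
  rw [← add_assoc, Real.Gamma_add_one h0.ne', add_sub_cancel_left, Real.rpow_one]
  gcongr
  exact add_le_max_mul hy

theorem GammaRatioLE.add_one_right {u : ℝ} (hu : 0 < u) : GammaRatioLE u (u + 1) := by
  have hm : 0 < min 1 u := by positivity
  refine ⟨(min 1 u)⁻¹, by positivity, fun y hy => ?_⟩
  have h0 : 0 < y + u := by linarith
  have hy1 : 0 < y + 1 := by linarith
  have h1 := Real.Gamma_pos_of_pos h0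
  rw [← add_assoc, Real.Gamma_add_one h0.ne', show u - (u + 1) = -1 by ring, Real.rpow_neg_one,
    ← mul_inv, inv_mul_eq_div, le_div_iff₀ (by positivity), mul_comm]
  gcongr
  exact min_mul_le_add hy

/-- Log-convexity of Γ, interpolating between y + u and y + u + 1. -/
theorem GammaRatioLE.add_left_of_mem_Icc {u θ : ℝ} (hu : 0 < u) (h0 : 0 ≤ θ) (h1 : θ ≤ 1) :
    GammaRatioLE (u + θ) u := by
  rcases h0.eq_or_lt with rfl | h0
  · simpa using GammaRatioLE.refl u
  rcases h1.eq_or_lt with rfl | h1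
  · exact GammaRatioLE.add_one_left hu
  refine ⟨max 1 u ^ θ, by positivity, fun y hy => ?_⟩
  have hyu : 0 < y + u := by linarith
  have hy1 : 0 < y + 1 := by linarith
  have hG := Real.Gamma_pos_of_pos hyu
  have h := Real.Gamma_mul_add_mul_le_rpow_Gamma_mul_rpow_Gamma hyu
    (show 0 < y + u + 1 by linarith) (sub_pos.2 h1) h0 (by ring)
  rw [Real.Gamma_add_one hyu.ne', Real.mul_rpow hyu.le hG.le] at h
  calc Real.Gamma (y + (u + θ)) = Real.Gamma ((1 - θ) * (y + u) + θ * (y + u + 1)) := by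
        congr 1; ring
    _ ≤ _ := h
    _ = (y + u) ^ θ * (Real.Gamma (y + u) ^ (1 - θ) * Real.Gamma (y + u) ^ θ) := by ring
    _ = (y + u) ^ θ * Real.Gamma (y + u) := by
        rw [← Real.rpow_add hG, sub_add_cancel, Real.rpow_one]
    _ ≤ (max 1 u * (y + 1)) ^ θ * Real.Gamma (y + u) := by
        gcongr; exact add_le_max_mul hy
    _ = _ := by
        rw [Real.mul_rpow (by positivity) hy1.le, add_sub_cancel_left]

/-- Compare with u + 1 by the functional equation, then come down to u + θ by the convexity bound
with 1 - θ. -/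
theorem GammaRatioLE.add_right_of_mem_Icc {u θ : ℝ} (hu : 0 < u) (h0 : 0 ≤ θ) (h1 : θ ≤ 1) :
    GammaRatioLE u (u + θ) := by
  have h := GammaRatioLE.add_left_of_mem_Icc (u := u + θ) (θ := 1 - θ) (by linarith)
    (by linarith) (by linarith)
  rw [show u + θ + (1 - θ) = u + 1 by ring] at h
  exact (GammaRatioLE.add_one_right hu).trans h

theorem GammaRatioLE.add_nat {u : ℝ} (hu : 0 < u) (N : ℕ) :
    GammaRatioLE (u + N) u ∧ GammaRatioLE u (u + N) := by
  induction N with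
  | zero => simpa using GammaRatioLE.refl u
  | succ N ih =>
    have h : 0 < u + N := by positivity
    rw [Nat.cast_succ, ← add_assoc]
    exact ⟨(GammaRatioLE.add_one_left h).trans ih.1, ih.2.trans (GammaRatioLE.add_one_right h)⟩

theorem gammaRatioLE_of_le {u v : ℝ} (hu : 0 < u) (h : u ≤ v) :
    GammaRatioLE v u ∧ GammaRatioLE u v := by
  have hN := GammaRatioLE.add_nat hu ⌊v - u⌋₊
  have h1 := Nat.floor_le (sub_nonneg.2 h)
  have h2 := (Nat.lt_floor_add_one (v - u)).le
  have hp : 0 < u + ⌊v - u⌋₊ := by positivity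
  have h3 := GammaRatioLE.add_left_of_mem_Icc (θ := v - u - ⌊v - u⌋₊) hp (by linarith) (by linarith)
  have h4 := GammaRatioLE.add_right_of_mem_Icc (θ := v - u - ⌊v - u⌋₊) hp (by linarith)
    (by linarith)
  rw [show u + ⌊v - u⌋₊ + (v - u - ⌊v - u⌋₊) = v by ring] at h3 h4
  exact ⟨h3.trans hN.1, hN.2.trans h4⟩

theorem gammaRatioLE {u v : ℝ} (hu : 0 < u) (hv : 0 < v) : GammaRatioLE u v := by
  rcases le_total u v with h | h
  · exact (gammaRatioLE_of_le hu h).2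
  · exact (gammaRatioLE_of_le hv h).1

end MHarmonic

/-! ### The weights and their moments -/

namespace MHarmonic

/-- The normalized coefficients of `S_{pq}`; they form a probability distribution on `ℕ`. -/
noncomputable def weight (n p q j : ℕ) : ℝ :=
  gaussTerm p q n j / (Real.Gamma n / (Real.Gamma (p + n) * Real.Gamma (q + n)))

/-- Twice the exponent of the `j`-th term of `t^{(p+q)/2} S_{pq}(t)`. -/
noncomputable def degree (p q j : ℕ) : ℝ := p + q + 2 * j

theorem gauss_value_pos (p q : ℕ) {ν : ℝ} (hν : 0 < ν) :
    0 < Real.Gamma ν / (Real.Gamma (p + ν) * Real.Gamma (q + ν)) := by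
  have h1 := Real.Gamma_pos_of_pos hν
  have h2 := Real.Gamma_pos_of_pos (show 0 < (p : ℝ) + ν by positivity)
  have h3 := Real.Gamma_pos_of_pos (show 0 < (q : ℝ) + ν by positivity)
  positivity

theorem weight_nonneg {n : ℕ} (hn : 0 < n) (p q j : ℕ) : 0 ≤ weight n p q j := by
  have hn' : (0 : ℝ) < n := by exact_mod_cast hn
  exact div_nonneg (gaussTerm_nonneg p q hn' j) (gauss_value_pos p q hn').le

theorem hasSum_weight {n : ℕ} (hn : 0 < n) (p q : ℕ) : HasSum (weight n p q) 1 := by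
  have hn' : (0 : ℝ) < n := by exact_mod_cast hn
  have h := (hasSum_gaussTerm p q hn').div_const
    (Real.Gamma n / (Real.Gamma (p + n) * Real.Gamma (q + n)))
  rwa [div_self (gauss_value_pos p q hn').ne'] at h

theorem weight_le_one {n : ℕ} (hn : 0 < n) (p q j : ℕ) : weight n p q j ≤ 1 :=
  le_hasSum (hasSum_weight hn p q) j fun i _ => weight_nonneg hn p q i

theorem degree_nonneg (p q j : ℕ) : 0 ≤ degree p q j := by
  unfold degree; positivity

theorem degree_pos {p q : ℕ} (h : 0 < p + q) (j : ℕ) : 0 < degree p q j := by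
  have : (0 : ℝ) < p + q := by exact_mod_cast h
  unfold degree; positivity

theorem rpow_le_of_comparable {a b : ℝ} (ha : 0 < a) (hb : 0 < b) (hab : a ≤ 2 * b)
    (hba : b ≤ 2 * a) (r : ℝ) : a ^ r ≤ 2 ^ |r| * b ^ r := by
  rcases le_total 0 r with hr | hr
  · rw [abs_of_nonneg hr, ← Real.mul_rpow zero_le_two hb.le]
    gcongr
  · rw [abs_of_nonpos hr, Real.rpow_neg zero_le_two, ← div_eq_inv_mul,
      ← Real.div_rpow hb.le zero_le_two]
    exact Real.rpow_le_rpow_of_nonpos (by positivity) (by linarith) hr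

/-- Only the Gamma factor depends on the parameter, so changing the parameter absorbs a power of p +
q + j + 1. -/
theorem gaussTerm_mul_rpow_le {u v : ℝ} (hu : 0 < u) (hv : 0 < v) :
    ∃ C : ℝ, 0 < C ∧ ∀ p q j : ℕ, gaussTerm p q u j * ((p : ℝ) + q + j + 1) ^ (u - v) ≤
      C * gaussTerm p q v j := by
  obtain ⟨C, hC, h⟩ := gammaRatioLE hv hu
  refine ⟨C, hC, fun p q j => ?_⟩
  have h1 := h (p + q + j) (by positivity)
  have hp := ascPochhammer_eval_natCast_nonneg p j
  have hq := ascPochhammer_eval_natCast_nonneg q j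
  have hu' := Real.Gamma_pos_of_pos (show 0 < (p : ℝ) + q + u + j by positivity)
  have hv' := Real.Gamma_pos_of_pos (show 0 < (p : ℝ) + q + v + j by positivity)
  have hy : (0 : ℝ) < p + q + j + 1 := by positivity
  rw [show (p : ℝ) + q + j + v = p + q + v + j by ring,
    show (p : ℝ) + q + j + u = p + q + u + j by ring, ← neg_sub u v, Real.rpow_neg hy.le] at h1
  have hr : 0 < ((p : ℝ) + q + j + 1) ^ (u - v) := by positivity
  have key : (Real.Gamma (p + q + u + j))⁻¹ * ((p : ℝ) + q + j + 1) ^ (u - v) ≤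
      C * (Real.Gamma (p + q + v + j))⁻¹ := by
    rw [inv_mul_eq_div, ← div_eq_mul_inv, div_le_div_iff₀ hu' hv']
    calc ((p : ℝ) + q + j + 1) ^ (u - v) * Real.Gamma (p + q + v + j)
        ≤ ((p : ℝ) + q + j + 1) ^ (u - v) * (C * (((p : ℝ) + q + j + 1) ^ (u - v))⁻¹ *
          Real.Gamma (p + q + u + j)) := by gcongr
      _ = C * Real.Gamma (p + q + u + j) := by field_simp
  unfold gaussTerm
  calc _ = (j.factorial : ℝ)⁻¹ * (ascPochhammer ℝ j).eval (p : ℝ) *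
        (ascPochhammer ℝ j).eval (q : ℝ) *
        ((Real.Gamma (p + q + u + j))⁻¹ * ((p : ℝ) + q + j + 1) ^ (u - v)) := by ring
    _ ≤ (j.factorial : ℝ)⁻¹ * (ascPochhammer ℝ j).eval (p : ℝ) *
        (ascPochhammer ℝ j).eval (q : ℝ) * (C * (Real.Gamma (p + q + v + j))⁻¹) := by gcongr
    _ = _ := by ring

theorem gauss_value_div_le {u v : ℝ} (hu : 0 < u) (hv : 0 < v) :
    ∃ C : ℝ, 0 < C ∧ ∀ p q : ℕ,
      Real.Gamma v / (Real.Gamma (p + v) * Real.Gamma (q + v)) /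
        (Real.Gamma u / (Real.Gamma (p + u) * Real.Gamma (q + u))) ≤
      C * (((p : ℝ) + 1) * ((q : ℝ) + 1)) ^ (u - v) := by
  obtain ⟨C, hC, h⟩ := gammaRatioLE hu hv
  have gu := Real.Gamma_pos_of_pos hu
  have gv := Real.Gamma_pos_of_pos hv
  refine ⟨Real.Gamma v / Real.Gamma u * (C * C), by positivity, fun p q => ?_⟩
  have hp := h p (by positivity)
  have hq := h q (by positivity)
  have pu := Real.Gamma_pos_of_pos (show 0 < (p : ℝ) + u by positivity)
  have pv := Real.Gamma_pos_of_pos (show 0 < (p : ℝ) + v by positivity)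
  have qu := Real.Gamma_pos_of_pos (show 0 < (q : ℝ) + u by positivity)
  have qv := Real.Gamma_pos_of_pos (show 0 < (q : ℝ) + v by positivity)
  rw [← div_le_iff₀ pv] at hp
  rw [← div_le_iff₀ qv] at hq
  rw [Real.mul_rpow (by positivity) (by positivity)]
  calc _ = Real.Gamma v / Real.Gamma u * ((Real.Gamma (p + u) / Real.Gamma (p + v)) *
        (Real.Gamma (q + u) / Real.Gamma (q + v))) := by field_simp
    _ ≤ Real.Gamma v / Real.Gamma u * ((C * ((p : ℝ) + 1) ^ (u - v)) *
        (C * ((q : ℝ) + 1) ^ (u - v))) := by gcongr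
    _ = _ := by ring

/-- The moments of order `r < n` of the weights, uniformly in `p` and `q`. -/
theorem moment_le {n : ℕ} (hn : 0 < n) {r : ℝ} (hr : r < n) :
    ∃ C : ℝ, 0 < C ∧ ∀ p q : ℕ, 0 < p + q →
      Summable (fun j => weight n p q j * degree p q j ^ r) ∧
      ∑' j, weight n p q j * degree p q j ^ r ≤ C * (((p : ℝ) + 1) * ((q : ℝ) + 1)) ^ r := by
  have hu : (0 : ℝ) < n := by exact_mod_cast hn
  have hv : (0 : ℝ) < n - r := sub_pos.2 hr
  obtain ⟨C, hC, h1⟩ := gaussTerm_mul_rpow_le hu hv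
  obtain ⟨D, hD, h2⟩ := gauss_value_div_le hu hv
  -- The new parameter is n - r, positive exactly because r < n, so both exponents become r.
  rw [sub_sub_cancel] at h1 h2
  refine ⟨2 ^ |r| * C * D, by positivity, fun p q hpq => ?_⟩
  have hG := gauss_value_pos p q hu
  set G := Real.Gamma n / (Real.Gamma (p + n) * Real.Gamma (q + n)) with hGdef
  have hpq' : (1 : ℝ) ≤ p + q := by exact_mod_cast hpq
  have hle (j : ℕ) : weight n p q j * degree p q j ^ r ≤
      2 ^ |r| * C * (gaussTerm p q (n - r) j / G) := by
    have hg := gaussTerm_nonneg p q hu j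
    have hj : (0 : ℝ) ≤ j := j.cast_nonneg
    -- The degree and p + q + j + 1 agree up to a factor 2 because p + q ≥ 1.
    have h3 := rpow_le_of_comparable (degree_pos hpq j)
      (show (0 : ℝ) < p + q + j + 1 by positivity) (by unfold degree; linarith)
      (by unfold degree; linarith) r
    calc weight n p q j * degree p q j ^ r
        ≤ gaussTerm p q n j / G * (2 ^ |r| * ((p : ℝ) + q + j + 1) ^ r) := by
          unfold weight; gcongr
      _ = 2 ^ |r| * (gaussTerm p q n j * ((p : ℝ) + q + j + 1) ^ r) / G := by ring
      _ ≤ 2 ^ |r| * (C * gaussTerm p q (n - r) j) / G := by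
          gcongr 2 ^ |r| * ?_ / G
          exact h1 p q j
      _ = _ := by ring
  have hsum := ((hasSum_gaussTerm p q hv).div_const G).mul_left (2 ^ |r| * C)
  have hs : Summable (fun j => weight n p q j * degree p q j ^ r) :=
    hsum.summable.of_nonneg_of_le
      (fun j => mul_nonneg (weight_nonneg hn p q j) (Real.rpow_nonneg (degree_nonneg p q j) r)) hle
  refine ⟨hs, (hs.tsum_le_tsum hle hsum.summable).trans ?_⟩
  rw [hsum.tsum_eq, mul_assoc _ D]
  gcongr
  exact h2 p q

/-! ### Series for the iterated derivatives -/

theorem ordinaryHypergeometric_eq_tsum_weight {n : ℕ} (hn : 0 < n) (p q : ℕ) (t : ℝ) :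
    ₂F₁ (p : ℝ) (q : ℝ) ((p : ℝ) + q + n) t =
      Real.Gamma (p + q + n) * (Real.Gamma n / (Real.Gamma (p + n) * Real.Gamma (q + n))) *
        ∑' j, weight n p q j * t ^ j := by
  have hn' : (0 : ℝ) < n := by exact_mod_cast hn
  have h0 : (0 : ℝ) < p + q + n := by positivity
  have hG := gauss_value_pos p q hn'
  rw [ordinaryHypergeometric_eq_tsum, ← tsum_mul_left]
  refine tsum_congr fun j => ?_
  have h1 := Real.Gamma_pos_of_pos h0
  have h2 := ascPochhammer_pos j _ h0
  rw [weight, gaussTerm, gamma_add_nat_eq_ascPochhammer h0, smul_eq_mul]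
  field_simp

theorem S_eq_tsum {n : ℕ} (hn : 0 < n) (p q : ℕ) (t : ℝ) :
    S n p q t = ∑' j, weight n p q j * t ^ j := by
  have hn' : (0 : ℝ) < n := by exact_mod_cast hn
  have h0 := Real.Gamma_pos_of_pos (show (0 : ℝ) < p + q + n by positivity)
  have hG := gauss_value_pos p q hn'
  rw [S, ordinaryHypergeometric_eq_tsum_weight hn, ordinaryHypergeometric_eq_tsum_weight hn]
  simp only [one_pow, mul_one]
  rw [(hasSum_weight hn p q).tsum_eq, mul_one, mul_div_assoc, mul_comm, div_mul_cancel₀]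
  positivity

/-- The value of `(2 t ∂/∂t)^k (t^{(p+q)/2} S_{pq}(t))` on `(0, 1)`, as a series. -/
noncomputable def radialSeries (n p q k : ℕ) (t : ℝ) : ℝ :=
  ∑' j, weight n p q j * degree p q j ^ k * t ^ (degree p q j / 2)

theorem summable_degree_pow_mul_rpow (p q k : ℕ) {t : ℝ} (ht : t ∈ Ioo (0 : ℝ) 1) :
    Summable fun j => degree p q j ^ k * t ^ (degree p q j / 2) := by
  have h1 : Summable fun j : ℕ => (j : ℝ) ^ k * t ^ j :=
    summable_pow_mul_geometric_of_norm_lt_one k (by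
      rw [Real.norm_eq_abs, abs_of_pos ht.1]; exact ht.2)
  have h2 : Summable fun j : ℕ => t ^ j := summable_geometric_of_lt_one ht.1.le ht.2
  refine ((((h2.mul_left (((p : ℝ) + q) ^ k)).add (h1.mul_left (2 ^ k))).mul_left
    (2 ^ (k - 1))).mul_left (t ^ (((p : ℝ) + q) / 2))).of_nonneg_of_le (fun j => ?_) fun j => ?_
  · have := degree_nonneg p q j
    have := Real.rpow_nonneg ht.1.le (degree p q j / 2)
    positivity
  · have h3 : t ^ (degree p q j / 2) = t ^ (((p : ℝ) + q) / 2) * t ^ j := by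
      rw [← Real.rpow_add_natCast ht.1.ne', degree]; congr 1; ring
    have h4 : degree p q j ^ k ≤ 2 ^ (k - 1) * (((p : ℝ) + q) ^ k + 2 ^ k * (j : ℝ) ^ k) := by
      rw [← mul_pow]
      exact add_pow_le (by positivity) (by positivity) k
    have := ht.1
    rw [h3]
    calc _ ≤ 2 ^ (k - 1) * (((p : ℝ) + q) ^ k + 2 ^ k * (j : ℝ) ^ k) *
          (t ^ (((p : ℝ) + q) / 2) * t ^ j) := by gcongr
      _ = _ := by ring

theorem summable_radialSeries {n : ℕ} (hn : 0 < n) (p q k : ℕ) {t : ℝ} (ht : t ∈ Ioo (0 : ℝ) 1) :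
    Summable fun j => weight n p q j * degree p q j ^ k * t ^ (degree p q j / 2) := by
  refine (summable_degree_pow_mul_rpow p q k ht).of_nonneg_of_le (fun j => ?_) fun j => ?_
  all_goals
    have := degree_nonneg p q j
    have := weight_nonneg hn p q j
    have := Real.rpow_nonneg ht.1.le (degree p q j / 2)
  · positivity
  · rw [mul_assoc]
    exact mul_le_of_le_one_left (by positivity) (weight_le_one hn p q j)

theorem hasDerivAt_radialSeries {n : ℕ} (hn : 0 < n) (p q k : ℕ) {t : ℝ}
    (ht : t ∈ Ioo (0 : ℝ) 1) :
    HasDerivAt (radialSeries n p q k) (radialSeries n p q (k + 1) t / (2 * t)) t := by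
  -- Termwise differentiation on (a, b): b dominates the powers of the variable and a the factor
  -- 1/(2y).
  obtain ⟨a, ha0, hat⟩ := exists_between ht.1
  obtain ⟨b, htb, hb1⟩ := exists_between ht.2
  have hb : b ∈ Ioo (0 : ℝ) 1 := ⟨ht.1.trans htb, hb1⟩
  have h := hasDerivAt_tsum_of_isPreconnected (t := Ioo a b) (y₀ := t) (y := t)
    (u := fun j => degree p q j ^ (k + 1) * b ^ (degree p q j / 2) / (2 * a))
    (g := fun j t => weight n p q j * degree p q j ^ k * t ^ (degree p q j / 2))
    (g' := fun j t => weight n p q j * degree p q j ^ (k + 1) * t ^ (degree p q j / 2) / (2 * t))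
    ((summable_degree_pow_mul_rpow p q (k + 1) hb).div_const (2 * a)) isOpen_Ioo
    isPreconnected_Ioo ?_ ?_ ⟨hat, htb⟩ (summable_radialSeries hn p q k ht) ⟨hat, htb⟩
  · rw [tsum_div_const] at h
    exact h
  · intro j y hy
    have hy0 : 0 < y := ha0.trans hy.1
    have h1 := (Real.hasDerivAt_rpow_const (p := degree p q j / 2) (Or.inl hy0.ne')).const_mul
      (weight n p q j * degree p q j ^ k)
    refine h1.congr_deriv ?_
    rw [Real.rpow_sub_one hy0.ne', pow_succ]
    field_simp
  · intro j y hy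
    have hy0 : 0 < y := ha0.trans hy.1
    have hd := degree_nonneg p q j
    have hw := weight_nonneg hn p q j
    have hr := Real.rpow_nonneg hy0.le (degree p q j / 2)
    rw [Real.norm_eq_abs, abs_of_nonneg (by positivity)]
    have hbr := Real.rpow_nonneg hb.1.le (degree p q j / 2)
    have h2 : y ^ (degree p q j / 2) ≤ b ^ (degree p q j / 2) :=
      Real.rpow_le_rpow hy0.le hy.2.le (by positivity)
    calc weight n p q j * degree p q j ^ (k + 1) * y ^ (degree p q j / 2) / (2 * y)
        ≤ 1 * degree p q j ^ (k + 1) * b ^ (degree p q j / 2) / (2 * a) := by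
          gcongr
          · exact weight_le_one hn p q j
          · exact hy.1.le
      _ = _ := by rw [one_mul]

theorem radialPart_eq_radialSeries {n : ℕ} (hn : 0 < n) (p q : ℕ) {t : ℝ} (ht : 0 < t) :
    radialPart n p q t = radialSeries n p q 0 t := by
  rw [radialPart, S_eq_tsum hn, radialSeries, ← tsum_mul_left]
  refine tsum_congr fun j => ?_
  have h3 : t ^ (degree p q j / 2) = t ^ (((p : ℝ) + q) / 2) * t ^ j := by
    rw [← Real.rpow_add_natCast ht.ne', degree]; congr 1; ring
  rw [h3]; ring

theorem iterate_normalOp_radialPart {n : ℕ} (hn : 0 < n) (p q k : ℕ) {t : ℝ}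
    (ht : t ∈ Ioo (0 : ℝ) 1) :
    normalOp^[k] (radialPart n p q) t = radialSeries n p q k t := by
  induction k generalizing t with
  | zero => exact radialPart_eq_radialSeries hn p q ht.1
  | succ k ih =>
    rw [Function.iterate_succ_apply', normalOp]
    have h : normalOp^[k] (radialPart n p q) =ᶠ[nhds t] radialSeries n p q k := by
      filter_upwards [isOpen_Ioo.mem_nhds ht] with x hx using ih hx
    rw [h.deriv_eq, (hasDerivAt_radialSeries hn p q k ht).deriv]
    have := ht.1.ne'
    field_simp

end MHarmonic

/-! ### Upper bound -/

namespace MHarmonic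

/-- Since t ≤ exp(t - 1), the reflection u = 1 - t bounds the integral by part of a Gamma integral.
-/
theorem setLIntegral_rpow_mul_one_sub_rpow_le {s x : ℝ} (hs : -1 < s) (hx : 0 < x) :
    ∫⁻ t in Ioo (0 : ℝ) 1, ENNReal.ofReal (t ^ x * (1 - t) ^ s) ≤
      ENNReal.ofReal (Real.Gamma (s + 1) * x ^ (-(s + 1))) := by
  have hs' : 0 < s + 1 := by linarith
  have hkey := Real.integral_rpow_mul_exp_neg_mul_Ioi hs' hx
  -- A nonintegrable function has Bochner integral 0, so the nonzero value proves integrability.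
  have hint : IntegrableOn (fun u : ℝ => u ^ (s + 1 - 1) * Real.exp (-(x * u))) (Ioi 0) :=
    .of_integral_ne_zero (by
      rw [hkey]
      have := Real.Gamma_pos_of_pos hs'
      positivity)
  have hval : ∫⁻ u in Ioi (0 : ℝ), ENNReal.ofReal (u ^ (s + 1 - 1) * Real.exp (-(x * u))) =
      ENNReal.ofReal (Real.Gamma (s + 1) * x ^ (-(s + 1))) := by
    rw [← ofReal_integral_eq_lintegral_ofReal hint, hkey, one_div, Real.inv_rpow hx.le,
      Real.rpow_neg hx.le, mul_comm]
    filter_upwards [ae_restrict_mem measurableSet_Ioi] with u hu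
    have : (0 : ℝ) < u := hu
    positivity
  have hmp := ((volume : Measure ℝ).measurePreserving_sub_left 1).setLIntegral_comp_emb
    (measurableEmbedding_subLeft (1 : ℝ))
    (fun u : ℝ => ENNReal.ofReal (u ^ (s + 1 - 1) * Real.exp (-(x * u)))) (Ioo 0 1)
  rw [show (fun t : ℝ => 1 - t) '' Ioo 0 1 = Ioo 0 1 by
    rw [image_const_sub_Ioo]; simp] at hmp
  rw [← hval]
  calc _ ≤ ∫⁻ t in Ioo (0 : ℝ) 1,
        ENNReal.ofReal ((1 - t) ^ (s + 1 - 1) * Real.exp (-(x * (1 - t)))) := by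
        refine setLIntegral_mono' measurableSet_Ioo fun t ht => ENNReal.ofReal_le_ofReal ?_
        have h1 : 0 < 1 - t := sub_pos.2 ht.2
        rw [add_sub_cancel_right, mul_comm]
        gcongr
        calc t ^ x ≤ Real.exp (t - 1) ^ x := by
              refine Real.rpow_le_rpow ht.1.le ?_ hx.le
              linarith [Real.add_one_le_exp (t - 1)]
          _ = _ := by rw [← Real.exp_mul]; congr 1; ring
    _ = _ := hmp
    _ ≤ _ := lintegral_mono_set Ioo_subset_Ioi_self

/-- AM-GM; this turns the double sum over i, j into a product of two single sums. -/
theorem add_half_rpow_neg_le {a b σ : ℝ} (ha : 0 < a) (hb : 0 < b) (hσ : 0 ≤ σ) :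
    ((a + b) / 2) ^ (-σ) ≤ a ^ (-σ / 2) * b ^ (-σ / 2) := by
  have h1 : (a * b) ^ (1 / 2 : ℝ) ≤ (a + b) / 2 := by
    rw [← Real.sqrt_eq_rpow, Real.sqrt_le_left (by positivity)]
    nlinarith [sq_nonneg (a - b)]
  calc ((a + b) / 2) ^ (-σ) ≤ ((a * b) ^ (1 / 2 : ℝ)) ^ (-σ) :=
        Real.rpow_le_rpow_of_nonpos (by positivity) h1 (by linarith)
    _ = _ := by
        rw [← Real.rpow_mul (by positivity), ← Real.mul_rpow ha.le hb.le]
        congr 1; ring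

theorem lintegral_mul_tsum_sq {α : Type*} [MeasurableSpace α] {μ : Measure α} {w : α → ℝ≥0∞}
    {f : ℕ → α → ℝ≥0∞} (hw : AEMeasurable w μ) (hf : ∀ i, AEMeasurable (f i) μ) :
    ∫⁻ x, w x * (∑' i, f i x) ^ 2 ∂μ = ∑' i, ∑' j, ∫⁻ x, w x * (f i x * f j x) ∂μ := by
  have h (x : α) : w x * (∑' i, f i x) ^ 2 = ∑' i, ∑' j, w x * (f i x * f j x) := by
    simp_rw [sq, ENNReal.tsum_mul_left, ENNReal.tsum_mul_right]
  simp_rw [h]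
  have hm (i j : ℕ) : AEMeasurable (fun x => w x * (f i x * f j x)) μ :=
    hw.mul ((hf i).mul (hf j))
  rw [lintegral_tsum fun i => AEMeasurable.tsum fun j => hm i j]
  exact tsum_congr fun i => lintegral_tsum (hm i)

theorem setLIntegral_radialSeries_term_le {n : ℕ} (hn : 0 < n) {s : ℝ} (hs : -1 < s) {p q : ℕ}
    (hpq : 0 < p + q) (k i j : ℕ) :
    ∫⁻ t in Ioo (0 : ℝ) 1, ENNReal.ofReal (t ^ ((n : ℝ) - 1) * (1 - t) ^ s) *
      (ENNReal.ofReal (weight n p q i * degree p q i ^ k * t ^ (degree p q i / 2)) *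
        ENNReal.ofReal (weight n p q j * degree p q j ^ k * t ^ (degree p q j / 2))) ≤
      ENNReal.ofReal (Real.Gamma (s + 1)) *
        (ENNReal.ofReal (weight n p q i * degree p q i ^ ((k : ℝ) - (s + 1) / 2)) *
          ENNReal.ofReal (weight n p q j * degree p q j ^ ((k : ℝ) - (s + 1) / 2))) := by
  have hs' : 0 < s + 1 := by linarith
  have hG := Real.Gamma_pos_of_pos hs'
  have hn1 : (1 : ℝ) ≤ n := by exact_mod_cast hn
  have hi := degree_pos hpq i
  have hj := degree_pos hpq j
  have hwi := weight_nonneg hn p q i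
  have hwj := weight_nonneg hn p q j
  set x := (degree p q i + degree p q j) / 2 with hxdef
  have hx : 0 < x := by positivity
  set A := weight n p q i * degree p q i ^ k * (weight n p q j * degree p q j ^ k) with hA
  have hA0 : 0 ≤ A := by positivity
  calc _ ≤ ∫⁻ t in Ioo (0 : ℝ) 1, ENNReal.ofReal A * ENNReal.ofReal (t ^ x * (1 - t) ^ s) := by
        refine setLIntegral_mono' measurableSet_Ioo fun t ht => ?_
        have ht0 : 0 < t := ht.1
        have h1 : 0 < 1 - t := sub_pos.2 ht.2
        rw [← ENNReal.ofReal_mul (by positivity), ← ENNReal.ofReal_mul (by positivity),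
          ← ENNReal.ofReal_mul hA0]
        refine ENNReal.ofReal_le_ofReal ?_
        have h2 : t ^ ((n : ℝ) - 1) ≤ 1 := Real.rpow_le_one ht0.le ht.2.le (by linarith)
        have h3 : t ^ x = t ^ (degree p q i / 2) * t ^ (degree p q j / 2) := by
          rw [← Real.rpow_add ht0]; congr 1; rw [hxdef]; ring
        calc _ = t ^ ((n : ℝ) - 1) * (A * (t ^ x * (1 - t) ^ s)) := by rw [h3, hA]; ring
          _ ≤ _ := mul_le_of_le_one_left (by positivity) h2
    _ = ENNReal.ofReal A * ∫⁻ t in Ioo (0 : ℝ) 1, ENNReal.ofReal (t ^ x * (1 - t) ^ s) :=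
        lintegral_const_mul' _ _ ENNReal.ofReal_ne_top
    _ ≤ ENNReal.ofReal A * ENNReal.ofReal (Real.Gamma (s + 1) * x ^ (-(s + 1))) := by
        gcongr; exact setLIntegral_rpow_mul_one_sub_rpow_le hs hx
    _ ≤ _ := by
        rw [← ENNReal.ofReal_mul hA0, ← ENNReal.ofReal_mul (by positivity),
          ← ENNReal.ofReal_mul hG.le]
        refine ENNReal.ofReal_le_ofReal ?_
        have h4 := add_half_rpow_neg_le hi hj hs'.le
        have h5 (m : ℝ) (hm : 0 < m) :
            m ^ ((k : ℝ) - (s + 1) / 2) = m ^ k * m ^ (-(s + 1) / 2) := by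
          rw [← Real.rpow_natCast, ← Real.rpow_add hm]; congr 1; ring
        rw [h5 _ hi, h5 _ hj]
        calc A * (Real.Gamma (s + 1) * x ^ (-(s + 1)))
            ≤ A * (Real.Gamma (s + 1) *
              (degree p q i ^ (-(s + 1) / 2) * degree p q j ^ (-(s + 1) / 2))) := by gcongr
          _ = _ := by rw [hA]; ring

theorem c_eq_lintegral_radialSeries {n : ℕ} (hn : 0 < n) (p q k : ℕ) (s : ℝ) :
    c n p q k s = ∫⁻ t in Ioo (0 : ℝ) 1,
      ENNReal.ofReal (t ^ ((n : ℝ) - 1) * (1 - t) ^ s * (radialSeries n p q k t) ^ 2) :=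
  setLIntegral_congr_fun measurableSet_Ioo fun t ht => by
    simp only [iterate_normalOp_radialPart hn p q k ht]

theorem c_le {n : ℕ} (hn : 0 < n) {s : ℝ} (hs : -1 < s) {k : ℕ} (hk : k ≤ n) :
    ∃ b : ℝ, 0 < b ∧ ∀ p q : ℕ, 0 < p + q →
      c n p q k s ≤
        ENNReal.ofReal (b * (((p : ℝ) + 1) * ((q : ℝ) + 1)) ^ (2 * (k : ℝ) - s - 1)) := by
  have hs' : 0 < s + 1 := by linarith
  have hG := Real.Gamma_pos_of_pos hs'
  have hk' : (k : ℝ) ≤ n := by exact_mod_cast hk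
  -- The order is below n because k ≤ n and s > -1.
  obtain ⟨C, hC, h⟩ := moment_le hn (r := (k : ℝ) - (s + 1) / 2) (by linarith)
  refine ⟨Real.Gamma (s + 1) * C ^ 2, by positivity, fun p q hpq => ?_⟩
  obtain ⟨hsum, hle⟩ := h p q hpq
  have hnn (j : ℕ) : 0 ≤ weight n p q j * degree p q j ^ ((k : ℝ) - (s + 1) / 2) :=
    mul_nonneg (weight_nonneg hn p q j) (Real.rpow_nonneg (degree_nonneg p q j) _)
  have hM : (0 : ℝ) < ((p : ℝ) + 1) * ((q : ℝ) + 1) := by positivity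
  set M := ((p : ℝ) + 1) * ((q : ℝ) + 1)
  rw [c_eq_lintegral_radialSeries hn]
  calc _ = ∫⁻ t in Ioo (0 : ℝ) 1, ENNReal.ofReal (t ^ ((n : ℝ) - 1) * (1 - t) ^ s) *
        (∑' j, ENNReal.ofReal
          (weight n p q j * degree p q j ^ k * t ^ (degree p q j / 2))) ^ 2 := by
        refine setLIntegral_congr_fun measurableSet_Ioo fun t ht => ?_
        have ht0 : 0 < t := ht.1
        have h1 : 0 < 1 - t := sub_pos.2 ht.2
        have h2 (j : ℕ) : 0 ≤ weight n p q j * degree p q j ^ k * t ^ (degree p q j / 2) := by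
          have := weight_nonneg hn p q j
          have := degree_nonneg p q j
          positivity
        rw [ENNReal.ofReal_mul (by positivity), radialSeries, ENNReal.ofReal_pow (tsum_nonneg h2),
          ENNReal.ofReal_tsum_of_nonneg h2 (summable_radialSeries hn p q k ht)]
    _ = ∑' i, ∑' j, ∫⁻ t in Ioo (0 : ℝ) 1, ENNReal.ofReal (t ^ ((n : ℝ) - 1) * (1 - t) ^ s) *
        (ENNReal.ofReal (weight n p q i * degree p q i ^ k * t ^ (degree p q i / 2)) *
          ENNReal.ofReal (weight n p q j * degree p q j ^ k * t ^ (degree p q j / 2))) :=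
        lintegral_mul_tsum_sq (by fun_prop) fun i => by fun_prop
    _ ≤ ∑' i, ∑' j, ENNReal.ofReal (Real.Gamma (s + 1)) *
        (ENNReal.ofReal (weight n p q i * degree p q i ^ ((k : ℝ) - (s + 1) / 2)) *
          ENNReal.ofReal (weight n p q j * degree p q j ^ ((k : ℝ) - (s + 1) / 2))) :=
        ENNReal.tsum_le_tsum fun i => ENNReal.tsum_le_tsum fun j =>
          setLIntegral_radialSeries_term_le hn hs hpq k i j
    _ = ENNReal.ofReal (Real.Gamma (s + 1)) * (ENNReal.ofReal
          (∑' j, weight n p q j * degree p q j ^ ((k : ℝ) - (s + 1) / 2))) ^ 2 := by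
        rw [ENNReal.ofReal_tsum_of_nonneg hnn hsum]
        simp_rw [sq, ENNReal.tsum_mul_left, ENNReal.tsum_mul_right]
    _ ≤ ENNReal.ofReal (Real.Gamma (s + 1)) *
        (ENNReal.ofReal (C * M ^ ((k : ℝ) - (s + 1) / 2))) ^ 2 := by gcongr
    _ = _ := by
        rw [← ENNReal.ofReal_pow (by positivity), ← ENNReal.ofReal_mul hG.le, mul_pow,
          ← Real.rpow_mul_natCast hM.le, mul_assoc]
        congr 4
        push_cast
        ring

/-! ### Lower bound -/

/-- Integrals with weight `t^(n-1) (1-t)^s` of functions that are large near `t = 1`. -/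
theorem le_setLIntegral_of_le_near_one {n : ℕ} (hn : 0 < n) (s : ℝ) :
    ∃ a : ℝ, 0 < a ∧ ∀ (M B : ℝ) (g : ℝ → ℝ), 1 ≤ M → 0 ≤ B →
      (∀ t ∈ Ioo (1 - 1 / (2 * M)) (1 - 1 / (4 * M)), B ≤ g t) →
      ENNReal.ofReal (a * B ^ 2 * M ^ (-s - 1)) ≤
        ∫⁻ t in Ioo (0 : ℝ) 1, ENNReal.ofReal (t ^ ((n : ℝ) - 1) * (1 - t) ^ s * g t ^ 2) := by
  have hn1 : (1 : ℝ) ≤ n := by exact_mod_cast hn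
  -- The factors come from t ≥ 1/2, from 1/4 ≤ M(1 - t) ≤ 1/2 with either sign of s, and from the
  -- interval length 1/(4M).
  refine ⟨(1 / 2) ^ ((n : ℝ) - 1) * min ((1 / 2) ^ s) ((1 / 4) ^ s) * (1 / 4), by positivity,
    fun M B g hM hB hg => ?_⟩
  have hM0 : 0 < M := by linarith
  have hsub : Ioo (1 - 1 / (2 * M)) (1 - 1 / (4 * M)) ⊆ Ioo (0 : ℝ) 1 := by
    refine Ioo_subset_Ioo ?_ ?_
    · rw [sub_nonneg, div_le_one (by positivity)]; linarith
    · have : 0 < 1 / (4 * M) := by positivity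
      linarith
  calc _ = ∫⁻ _ in Ioo (1 - 1 / (2 * M)) (1 - 1 / (4 * M)),
        ENNReal.ofReal ((1 / 2) ^ ((n : ℝ) - 1) * (min ((1 / 2) ^ s) ((1 / 4) ^ s) * M ^ (-s)) *
          B ^ 2) := by
        rw [setLIntegral_const, Real.volume_Ioo, ← ENNReal.ofReal_mul (by positivity),
          Real.rpow_sub_one hM0.ne']
        congr 1
        field_simp
        ring
    _ ≤ ∫⁻ t in Ioo (1 - 1 / (2 * M)) (1 - 1 / (4 * M)),
        ENNReal.ofReal (t ^ ((n : ℝ) - 1) * (1 - t) ^ s * g t ^ 2) := by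
        refine setLIntegral_mono' measurableSet_Ioo fun t ht => ENNReal.ofReal_le_ofReal ?_
        have ht01 := hsub ht
        have h1 : 0 < 1 - t := sub_pos.2 ht01.2
        have ht0 := ht01.1
        have hhalf : 1 / 2 ≤ t := by
          have : 1 / (2 * M) ≤ 1 / 2 := one_div_le_one_div_of_le two_pos (by linarith)
          linarith [ht.1]
        have hBg := hg t ht
        have hpow : min ((1 / 2) ^ s) ((1 / 4) ^ s) * M ^ (-s) ≤ (1 - t) ^ s := by
          have e (x : ℝ) (hx : 0 ≤ x) : (x / M) ^ s = x ^ s * M ^ (-s) := by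
            rw [Real.div_rpow hx hM0.le, Real.rpow_neg hM0.le, div_eq_mul_inv]
          have l : (1 / 4) / M ≤ 1 - t := by
            have : 1 / (4 * M) = (1 / 4) / M := by field_simp
            linarith [ht.2]
          have u : 1 - t ≤ (1 / 2) / M := by
            have : 1 / (2 * M) = (1 / 2) / M := by field_simp
            linarith [ht.1]
          rcases le_total 0 s with hs | hs
          · calc _ ≤ (1 / 4) ^ s * M ^ (-s) := by gcongr; exact min_le_right _ _
              _ = ((1 / 4) / M) ^ s := (e _ (by norm_num)).symm
              _ ≤ _ := by gcongr
          · calc _ ≤ (1 / 2) ^ s * M ^ (-s) := by gcongr; exact min_le_left _ _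
              _ = ((1 / 2) / M) ^ s := (e _ (by norm_num)).symm
              _ ≤ _ := Real.rpow_le_rpow_of_nonpos h1 u hs
        have : (1 / 2 : ℝ) ^ ((n : ℝ) - 1) ≤ t ^ ((n : ℝ) - 1) :=
          Real.rpow_le_rpow (by norm_num) hhalf (by linarith)
        gcongr
    _ ≤ _ := lintegral_mono_set hsub

/-- A Markov-type argument: the moments of orders 1 and -1 leave at least half of the mass on
degrees between M/K and KM. Order 1 is admissible because n ≥ 2. -/
theorem le_radialSeries {n : ℕ} (hn : 2 ≤ n) (k : ℕ) :
    ∃ a : ℝ, 0 < a ∧ ∀ p q : ℕ, 0 < p + q →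
      ∀ t ∈ Ioo (0 : ℝ) 1, 1 - 1 / (2 * (((p : ℝ) + 1) * ((q : ℝ) + 1))) ≤ t →
        a * (((p : ℝ) + 1) * ((q : ℝ) + 1)) ^ k ≤ radialSeries n p q k t := by
  have hn0 : 0 < n := by lia
  have hn' : (2 : ℝ) ≤ n := by exact_mod_cast hn
  obtain ⟨C, hC, h1⟩ := moment_le hn0 (r := 1) (by linarith)
  obtain ⟨D, hD, h2⟩ := moment_le hn0 (r := -1) (by linarith)
  -- Chosen so that the two moment losses C/K and D/K add up to 1/2.
  set K := 2 * (C + D) with hK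
  have hK0 : 0 < K := by positivity
  refine ⟨K⁻¹ ^ k * (1 / 2) ^ (K / 2) / 2, by positivity, fun p q hpq t ht htM => ?_⟩
  obtain ⟨hs1, hle1⟩ := h1 p q hpq
  obtain ⟨hs2, hle2⟩ := h2 p q hpq
  have hM : (1 : ℝ) ≤ ((p : ℝ) + 1) * ((q : ℝ) + 1) := by
    have : (0 : ℝ) ≤ p := p.cast_nonneg
    have : (0 : ℝ) ≤ q := q.cast_nonneg
    nlinarith [mul_nonneg ‹(0 : ℝ) ≤ p› ‹(0 : ℝ) ≤ q›]
  set M := ((p : ℝ) + 1) * ((q : ℝ) + 1)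
  have hM0 : 0 < M := by linarith
  have ht0 : 0 < t := ht.1
  have htK : (1 / 2 : ℝ) ^ (K / 2) ≤ t ^ (K * M / 2) := by
    -- Bernoulli's inequality, to get t ^ M ≥ 1/2.
    have hb := one_add_mul_self_le_rpow_one_add (s := -(1 / (2 * M))) (p := M)
      (by
        have : 1 / (2 * M) ≤ 1 := by rw [div_le_one (by positivity)]; linarith
        linarith) hM
    have hb' : (1 / 2 : ℝ) ≤ t ^ M := by
      calc (1 / 2 : ℝ) = 1 + M * -(1 / (2 * M)) := by field_simp; ring
        _ ≤ _ := hb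
        _ ≤ _ := by
          refine Real.rpow_le_rpow ?_ (by linarith) hM0.le
          have : 1 / (2 * M) ≤ 1 := by rw [div_le_one (by positivity)]; linarith
          linarith
    calc (1 / 2 : ℝ) ^ (K / 2) ≤ (t ^ M) ^ (K / 2) := by gcongr
      _ = _ := by rw [← Real.rpow_mul ht0.le]; congr 1; ring
  set E := (K⁻¹ * M) ^ k * (1 / 2 : ℝ) ^ (K / 2) with hE
  have hE0 : 0 < E := by positivity
  -- The function 1 - m/(KM) - M/(Km) lies below the indicator of M/K ≤ m ≤ KM, and on that range
  -- m^k t^(m/2) ≥ E.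
  have hterm (j : ℕ) : E * (weight n p q j - weight n p q j * degree p q j ^ (1 : ℝ) / (K * M) -
      weight n p q j * degree p q j ^ (-1 : ℝ) * (M / K)) ≤
      weight n p q j * degree p q j ^ k * t ^ (degree p q j / 2) := by
    have hw := weight_nonneg hn0 p q j
    have hd := degree_pos hpq j
    rw [Real.rpow_one, Real.rpow_neg_one]
    set m := degree p q j
    have hfac : weight n p q j - weight n p q j * m / (K * M) - weight n p q j * m⁻¹ * (M / K) =
        weight n p q j * (1 - m / (K * M) - M / (K * m)) := by field_simp
    rw [hfac]
    have hm1 : 0 < m / (K * M) := by positivity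
    have hm2 : 0 < M / (K * m) := by positivity
    by_cases hneg : 1 - m / (K * M) - M / (K * m) ≤ 0
    · refine le_trans (mul_nonpos_of_nonneg_of_nonpos hE0.le
        (mul_nonpos_of_nonneg_of_nonpos hw hneg)) (by positivity)
    · push Not at hneg
      have hmu : m ≤ K * M := by
        rw [← div_le_one (by positivity)]; linarith
      have hml : K⁻¹ * M ≤ m := by
        have : M / (K * m) ≤ 1 := by linarith
        rw [div_le_one (by positivity)] at this
        rw [inv_mul_le_iff₀ hK0]; exact this
      calc E * (weight n p q j * (1 - m / (K * M) - M / (K * m)))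
          ≤ E * (weight n p q j * 1) := by gcongr; linarith
        _ = weight n p q j * (K⁻¹ * M) ^ k * (1 / 2 : ℝ) ^ (K / 2) := by rw [hE]; ring
        _ ≤ weight n p q j * m ^ k * t ^ (m / 2) := by
          gcongr
          exact htK.trans (Real.rpow_le_rpow_of_exponent_ge ht0 ht.2.le (by linarith))
  have hsum := (((hasSum_weight hn0 p q).sub (hs1.hasSum.div_const (K * M))).sub
    (hs2.hasSum.mul_right (M / K))).mul_left E
  have hfinal := hasSum_le hterm hsum (summable_radialSeries hn0 p q k ht).hasSum
  refine le_trans ?_ hfinal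
  have e1 : (∑' j, weight n p q j * degree p q j ^ (1 : ℝ)) / (K * M) ≤ C / K := by
    rw [div_le_div_iff₀ (by positivity) hK0]
    rw [Real.rpow_one] at hle1
    nlinarith
  have e2 : (∑' j, weight n p q j * degree p q j ^ (-1 : ℝ)) * (M / K) ≤ D / K := by
    rw [Real.rpow_neg_one] at hle2
    calc _ ≤ D * M⁻¹ * (M / K) := by gcongr
      _ = _ := by field_simp
  have e3 : C / K + D / K = 1 / 2 := by rw [hK]; field_simp
  calc K⁻¹ ^ k * (1 / 2) ^ (K / 2) / 2 * M ^ k = E * (1 / 2) := by rw [hE, mul_pow K⁻¹ M]; ring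
    _ ≤ _ := by gcongr; linarith

theorem le_c {n : ℕ} (hn : 2 ≤ n) (s : ℝ) (k : ℕ) :
    ∃ a : ℝ, 0 < a ∧ ∀ p q : ℕ, 0 < p + q →
      ENNReal.ofReal (a * (((p : ℝ) + 1) * ((q : ℝ) + 1)) ^ (2 * (k : ℝ) - s - 1)) ≤
        c n p q k s := by
  have hn0 : 0 < n := by lia
  obtain ⟨a, ha, h1⟩ := le_setLIntegral_of_le_near_one hn0 s
  obtain ⟨A, hA, h2⟩ := le_radialSeries hn k
  refine ⟨a * A ^ 2, by positivity, fun p q hpq => ?_⟩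
  have hM : (1 : ℝ) ≤ ((p : ℝ) + 1) * ((q : ℝ) + 1) := by
    have : (0 : ℝ) ≤ p := p.cast_nonneg
    have : (0 : ℝ) ≤ q := q.cast_nonneg
    nlinarith [mul_nonneg ‹(0 : ℝ) ≤ p› ‹(0 : ℝ) ≤ q›]
  rw [c_eq_lintegral_radialSeries hn0]
  have h3 := h1 _ (A * (((p : ℝ) + 1) * ((q : ℝ) + 1)) ^ k) (radialSeries n p q k) hM
    (by positivity) fun t ht => h2 p q hpq t ⟨lt_of_le_of_lt ?_ ht.1, ht.2.trans ?_⟩ ht.1.le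
  · refine le_of_eq_of_le ?_ h3
    have hM0 : 0 < ((p : ℝ) + 1) * ((q : ℝ) + 1) := by positivity
    congr 1
    rw [mul_pow, ← pow_mul, ← Real.rpow_natCast _ (k * 2),
      show 2 * (k : ℝ) - s - 1 = ((k * 2 : ℕ) : ℝ) + (-s - 1) by push_cast; ring,
      Real.rpow_add hM0]
    ring
  · rw [sub_nonneg, div_le_one (by positivity)]; linarith
  · have : 0 < 1 / (4 * (((p : ℝ) + 1) * ((q : ℝ) + 1))) := by positivity
    linarith

/-! ### The case p = q = 0 -/

theorem weight_zero_zero {n : ℕ} (hn : 0 < n) (j : ℕ) :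
    weight n 0 0 j = if j = 0 then 1 else 0 := by
  have hn' : (0 : ℝ) < n := by exact_mod_cast hn
  have := Real.Gamma_pos_of_pos hn'
  rcases eq_or_ne j 0 with rfl | hj
  · simp [weight, gaussTerm]
    field_simp
  · simp [weight, gaussTerm, hj]

/-- All mass sits at j = 0, where the degree is 0; the case split is the value of 0 ^ k. -/
theorem radialSeries_zero_zero {n : ℕ} (hn : 0 < n) (k : ℕ) (t : ℝ) :
    radialSeries n 0 0 k t = if k = 0 then 1 else 0 := by
  rw [radialSeries, tsum_eq_single 0 fun j hj => by simp [weight_zero_zero hn, hj]]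
  rcases eq_or_ne k 0 with rfl | hk
  · simp [weight_zero_zero hn, degree]
  · simp [degree, hk]

theorem c_zero_zero_of_pos {n : ℕ} (hn : 0 < n) (s : ℝ) {k : ℕ} (hk : 0 < k) :
    c n 0 0 k s = 0 := by
  simp [c_eq_lintegral_radialSeries hn, radialSeries_zero_zero hn, hk.ne']

theorem le_c_zero_zero {n : ℕ} (hn : 0 < n) (s : ℝ) :
    ∃ a : ℝ, 0 < a ∧ ENNReal.ofReal a ≤ c n 0 0 0 s := by
  obtain ⟨a, ha, h⟩ := le_setLIntegral_of_le_near_one hn s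
  refine ⟨a, ha, ?_⟩
  have h1 := h 1 1 (radialSeries n 0 0 0) le_rfl zero_le_one fun t _ => by
    simp [radialSeries_zero_zero hn]
  rwa [one_pow, mul_one, Real.one_rpow, mul_one, ← c_eq_lintegral_radialSeries hn] at h1

theorem c_zero_zero_le {n : ℕ} (hn : 2 ≤ n) {s : ℝ} (hs : -1 < s) :
    ∃ b : ℝ, 0 < b ∧ c n 0 0 0 s ≤ ENNReal.ofReal b := by
  have hn0 : 0 < n := by lia
  -- The Gamma bound is applied with exponent x = n - 1, which must be positive.
  have hn1 : (0 : ℝ) < (n : ℝ) - 1 := by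
    have : (2 : ℝ) ≤ n := by exact_mod_cast hn
    linarith
  have hG := Real.Gamma_pos_of_pos (show 0 < s + 1 by linarith)
  refine ⟨_, by positivity, le_trans (le_of_eq ?_) (setLIntegral_rpow_mul_one_sub_rpow_le hs hn1)⟩
  simp [c_eq_lintegral_radialSeries hn0, radialSeries_zero_zero hn0]

end MHarmonic

theorem proposition5 (n : ℕ) (hn : 2 ≤ n) (s : ℝ) (hs : -1 < s) (k : ℕ) (hk : k ≤ n) :
    ∃ a b : ℝ, 0 < a ∧ 0 < b ∧
      (k = 0 → ENNReal.ofReal a ≤ MHarmonic.c n 0 0 k s ∧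
        MHarmonic.c n 0 0 k s ≤ ENNReal.ofReal b) ∧
      (0 < k → MHarmonic.c n 0 0 k s = 0) ∧
      ∀ p q : ℕ, 0 < p + q →
        ENNReal.ofReal (a * (((p : ℝ) + 1) * ((q : ℝ) + 1)) ^ (2 * (k : ℝ) - s - 1))
            ≤ MHarmonic.c n p q k s ∧
          MHarmonic.c n p q k s
            ≤ ENNReal.ofReal (b * (((p : ℝ) + 1) * ((q : ℝ) + 1)) ^ (2 * (k : ℝ) - s - 1)) := by
  have hn0 : 0 < n := by lia
  obtain ⟨a₀, ha₀, hl₀⟩ := MHarmonic.le_c_zero_zero hn0 s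
  obtain ⟨b₀, hb₀, hu₀⟩ := MHarmonic.c_zero_zero_le hn hs
  obtain ⟨a₁, ha₁, hl₁⟩ := MHarmonic.le_c hn s k
  obtain ⟨b₁, hb₁, hu₁⟩ := MHarmonic.c_le hn0 hs hk
  refine ⟨min a₀ a₁, max b₀ b₁, lt_min ha₀ ha₁, lt_max_of_lt_left hb₀, ?_,
    MHarmonic.c_zero_zero_of_pos hn0 s, fun p q hpq => ⟨?_, ?_⟩⟩
  · rintro rfl
    exact ⟨(ENNReal.ofReal_le_ofReal (min_le_left _ _)).trans hl₀,
      hu₀.trans (ENNReal.ofReal_le_ofReal (le_max_left _ _))⟩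
  · refine (ENNReal.ofReal_le_ofReal ?_).trans (hl₁ p q hpq)
    gcongr
    exact min_le_right _ _
  · refine (hu₁ p q hpq).trans (ENNReal.ofReal_le_ofReal ?_)
    gcongr
    exact le_max_right _ _
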